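/- A 2-identity is a pair $(n,e)$ with $n=\{0,\dots,n-1\}$ a natural number and $e$ an equivalence relation on the set $[n]^2$ of two-element subsets of $n$. Let $\lambda,\mu$ be cardinals, regarded as initial ordinals. $\mathrm{ID}_2(\lambda,\mu)$ is the set of 2-identities $(n,e)$ such that for every $f:[\lambda]^{<\aleph_0}\to\mu$ there is a one-to-one function $h:n\to\lambda$ such that $b\,e\,c$ implies $f(h''(b))=f(h''(c))$; $\mathrm{OID}_2(\lambda,\mu)$ is defined in the same way, with $h$ required to be strictly increasing. For $k<\omega$ let $\mathbf s_k=\bigl(k+\binom k2,\,e_k\bigr)$, where two distinct pairs are $e_k$-equivalent if and only if both belong to $$A_k=\Bigl\{\bigl\{\ell_0,\;k+\tbinom{\ell_1}{2}+\ell_0\bigr\}:\ell_0<\ell_1<k\Bigr\}$$ or both belong to $$B_k=\Bigl\{\bigl\{\ell_1,\;k+\tbinom{\ell_1}{2}+\ell_0\bigr\}:\ell_0<\ell_1<k\Bigr\}.$$ A cardinal $\theta$ is compact if it is uncountable and regular and every $\theta$-complete proper filter on any set can be extended to a $\theta$-complete ultrafilter. 1) Let $\mu$ be a strong limit cardinal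 and $\theta$ a compact cardinal with $\mathrm{cf}(\mu)<\theta<\mu$. Then for every $k$, $\mathbf s_k\in\mathrm{ID}_2(\mu^+,\mu)$, and moreover $\mathbf s_k\in\mathrm{OID}_2(\mu^+,\mu)$. 2) For every $k\ge 3$, $\mathbf s_k\notin\mathrm{ID}_2(\aleph_1,\aleph_0)$; hence, for $\mu$ as in 1), $\mathbf s_k\in\mathrm{ID}_2(\mu^+,\mu)\setminus\mathrm{ID}_2(\aleph_1,\aleph_0)$. For $k=3$, $\mathbf s_3$ has $6$ points, and after interchanging the points $3$ and $5$ its non-singleton equivalence classes are exactly $\{\{1,3\},\{0,4\},\{0,5\}\}$ and $\{\{1,5\},\{2,3\},\{2,4\}\}$. -/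

import Mathlib

open Cardinal

universe u v

namespace TwoCardinal

/-- A partial identity with underlying set `α`: an equivalence relation on a family of finite
subsets of `α` (the family is `{b | rel b b}`), relating only sets of equal cardinality. -/
structure PartialIdentity (α : Type v) where
  rel : Finset α → Finset α → Prop
  symm : ∀ {b c}, rel b c → rel c b
  trans : ∀ {b c d}, rel b c → rel c d → rel b d
  card_eq : ∀ {b c}, rel b c → b.card = c.card

/-- `κ → (α, e)_μ`: for every `f : [κ]^{<ℵ₀} → μ` there is a one-to-one `h : α → κ` such that
`b e c` implies `f (h '' b) = f (h '' c)`. The cardinals `κ`, `μ` are taken as initial ordinals. -/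
def PartialIdentity.Arrow {α : Type v} (s : PartialIdentity α) (κ μ : Cardinal.{u}) : Prop :=
  ∀ f : Finset κ.ord.ToType → μ.ord.ToType,
    ∃ h : α ↪ κ.ord.ToType, ∀ b c : Finset α, s.rel b c → f (b.map h) = f (c.map h)

/-- `κ →_or (α, e)_μ` for a linearly ordered `α`: as `PartialIdentity.Arrow`, but `h` is required
to be order preserving (strictly increasing). -/
def PartialIdentity.OrdArrow {α : Type v} [LinearOrder α] (s : PartialIdentity α)
    (κ μ : Cardinal.{u}) : Prop :=
  ∀ f : Finset κ.ord.ToType → μ.ord.ToType,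
    ∃ h : α ↪o κ.ord.ToType, ∀ b c : Finset α, s.rel b c →
      f (b.map h.toEmbedding) = f (c.map h.toEmbedding)

/-- A 2-identity on `α`: an equivalence relation on `[α]²`. -/
abbrev TwoIdentity (α : Type v) : Type v := Setoid {b : Finset α // b.card = 2}

/-- The identity `e⁺` attached to a 2-identity `e`: `b e⁺ c` iff `b e c` or `b = c`. -/
def TwoIdentity.plus {α : Type v} (e : TwoIdentity α) : PartialIdentity α where
  rel b c := (∃ (hb : b.card = 2) (hc : c.card = 2), e ⟨b, hb⟩ ⟨c, hc⟩) ∨ b = c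
  symm := by
    rintro b c (⟨hb, hc, h⟩ | rfl)
    · exact Or.inl ⟨hc, hb, e.symm' h⟩
    · exact Or.inr rfl
  trans := by
    rintro b c d (⟨hb, hc, h⟩ | rfl) (⟨hc', hd, h'⟩ | rfl)
    · exact Or.inl ⟨hb, hd, e.trans' h h'⟩
    · exact Or.inl ⟨hb, hc, h⟩
    · exact Or.inl ⟨hc', hd, h'⟩
    · exact Or.inr rfl
  card_eq := by
    rintro b c (⟨hb, hc, -⟩ | rfl)
    · exact hb.trans hc.symm
    · rfl

/-- The equivalence classes of a 2-identity having more than one element, as sets of pairs. -/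
def TwoIdentity.nonsingletonClasses {α : Type v} (e : TwoIdentity α) : Set (Set (Finset α)) :=
  {C | ∃ D ∈ Setoid.classes e, D.Nontrivial ∧ C = Subtype.val '' D}

/-- `ID₂(κ, μ)`: the 2-identities `(n, e)`, `n < ω`, with `κ → (n, e)_μ`. -/
def ID₂ (κ μ : Cardinal.{u}) : Set (Σ n : ℕ, TwoIdentity (Fin n)) :=
  {s | s.2.plus.Arrow κ μ}

/-- `OID₂(κ, μ)`: the 2-identities `(n, e)`, `n < ω`, with `κ →_or (n, e)_μ`. -/
def OID₂ (κ μ : Cardinal.{u}) : Set (Σ n : ℕ, TwoIdentity (Fin n)) :=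
  {s | s.2.plus.OrdArrow κ μ}

/-- The pairs `{ℓ₀, k + C(ℓ₁, 2) + ℓ₀}` with `ℓ₀ < ℓ₁ < k`. -/
def lowClass (k : ℕ) : Set (Finset (Fin (k + k.choose 2))) :=
  {b | ∃ l₀ l₁ : ℕ, l₀ < l₁ ∧ l₁ < k ∧
    b.map Fin.valEmbedding = {l₀, k + l₁.choose 2 + l₀}}

/-- The pairs `{ℓ₁, k + C(ℓ₁, 2) + ℓ₀}` with `ℓ₀ < ℓ₁ < k`. -/
def highClass (k : ℕ) : Set (Finset (Fin (k + k.choose 2))) :=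
  {b | ∃ l₀ l₁ : ℕ, l₀ < l₁ ∧ l₁ < k ∧
    b.map Fin.valEmbedding = {l₁, k + l₁.choose 2 + l₀}}

theorem choose_two_add_inj {a b c d : ℕ} (hab : a < b) (hcd : c < d)
    (h : b.choose 2 + a = d.choose 2 + c) : b = d := by
  have key : ∀ {x y : ℕ}, x < y → x.choose 2 + x ≤ y.choose 2 := by
    intro x y hxy
    have h1 : (x + 1).choose 2 = x + x.choose 2 := by
      simp [Nat.choose_succ_succ]
    have h2 := Nat.choose_le_choose 2 (Nat.succ_le_of_lt hxy)
    rw [Nat.succ_eq_add_one] at h2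
    omega
  rcases lt_trichotomy b d with hlt | heq | hgt
  · have := key hlt
    omega
  · exact heq
  · have := key hgt
    omega

theorem not_mem_highClass_of_mem_lowClass {k : ℕ} {b : Finset (Fin (k + k.choose 2))}
    (hl : b ∈ lowClass k) : b ∉ highClass k := by
  rintro ⟨a₀, a₁, h1, h2, h3⟩
  obtain ⟨l₀, l₁, h4, h5, h6⟩ := hl
  rw [h6] at h3
  have m1 : l₀ ∈ ({a₁, k + a₁.choose 2 + a₀} : Finset ℕ) := by
    rw [← h3]
    simp
  have m2 : k + l₁.choose 2 + l₀ ∈ ({a₁, k + a₁.choose 2 + a₀} : Finset ℕ) := by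
    rw [← h3]
    simp
  simp only [Finset.mem_insert, Finset.mem_singleton] at m1 m2
  have e1 : l₀ = a₁ := by omega
  have e2 : l₁.choose 2 + l₀ = a₁.choose 2 + a₀ := by omega
  have := choose_two_add_inj h4 h1 e2
  omega

/-- The equivalence relation of `s_k`: its only classes that may have more than one element are
`lowClass k` and `highClass k`. -/
@[reducible]
def sRel (k : ℕ) : TwoIdentity (Fin (k + k.choose 2)) where
  r b c := b = c ∨ (b.1 ∈ lowClass k ∧ c.1 ∈ lowClass k) ∨ (b.1 ∈ highClass k ∧ c.1 ∈ highClass k)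
  iseqv :=
    { refl := fun _ => Or.inl rfl
      symm := by
        rintro b c (rfl | ⟨h, h'⟩ | ⟨h, h'⟩)
        · exact Or.inl rfl
        · exact Or.inr (Or.inl ⟨h', h⟩)
        · exact Or.inr (Or.inr ⟨h', h⟩)
      trans := by
        rintro b c d (rfl | ⟨h, h'⟩ | ⟨h, h'⟩) (rfl | ⟨g, g'⟩ | ⟨g, g'⟩)
        · exact Or.inl rfl
        · exact Or.inr (Or.inl ⟨g, g'⟩)
        · exact Or.inr (Or.inr ⟨g, g'⟩)
        · exact Or.inr (Or.inl ⟨h, h'⟩)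
        · exact Or.inr (Or.inl ⟨h, g'⟩)
        · exact absurd g (not_mem_highClass_of_mem_lowClass h')
        · exact Or.inr (Or.inr ⟨h, h'⟩)
        · exact absurd h' (not_mem_highClass_of_mem_lowClass g)
        · exact Or.inr (Or.inr ⟨h, g'⟩) }

/-- The 2-identity `s_k = (k + C(k, 2), e)`. -/
def sId (k : ℕ) : Σ n : ℕ, TwoIdentity (Fin n) := ⟨k + k.choose 2, sRel k⟩

/-- `θ` is a (strongly) compact cardinal: it is uncountable and regular, and every `θ`-complete
proper filter on any set extends to a `θ`-complete ultrafilter. -/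
def IsCompactCardinal (θ : Cardinal.{u}) : Prop :=
  ℵ₀ < θ ∧ θ.IsRegular ∧
    ∀ (X : Type u) (F : Filter X), F.NeBot → CardinalInterFilter F θ →
      ∃ U : Ultrafilter X, (U : Filter X) ≤ F ∧ CardinalInterFilter (U : Filter X) θ

end TwoCardinal

/-! Positive half. The filter `atTop` on μ⁺ is μ⁺-complete, so compactness extends it to a
θ-complete ultrafilter. As cf(μ) < θ, each γ ↦ f{α, γ} is almost everywhere bounded below μ, and a
single bound s serves μ⁺ many α. For two such α, α' some pair of colours below s equals (f{α, γ},
f{α', γ}) for cofinally many γ; Erdős–Rado makes it one pair (c₁, c₂) for all α < α' in a set of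
size k. Cofinality then lets the C(k, 2) remaining points be picked increasingly above that set
(`exists_frequently_homogeneous`, `sId_mem_OID₂`).

Negative half. Attach distinct subsets of ℕ to the points of ω₁ and colour α < β by a level M α β
together with both subsets truncated there; `exists_separating_level` chooses M so that β, the level
and the truncation of α determine α. Equally coloured pairs with a common point must share it as
lower point. Each s_k with k ≥ 3 contains a copy of s_3, where this makes 0 and 2 lower points; the
class with the higher level has the finer truncations, and they force 1 to coincide with 0 or with 2
(`HasLevelType.eq_of_le`). -/

/-! ### The Erdős–Rado theorem for pairs, by the tree argument. -/

section ErdosRado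

/-- The Erdős–Rado tree order of a colouring `c`: `y` precedes `x` if `y < x` and the predecessors
`z` of `y` do not distinguish `y` from `x`. -/
def ErdosRadoLT {X C : Type u} [LinearOrder X] [WellFoundedLT X] (c : X → X → C) (y x : X) : Prop :=
  y < x ∧ ∀ z, z < y → ErdosRadoLT c z y → c z y = c z x
termination_by wellFounded_lt.wrap y
decreasing_by assumption

variable {X C : Type u} [LinearOrder X] [WellFoundedLT X]

namespace ErdosRadoLT

variable {c : X → X → C}

theorem lt {y x : X} (h : ErdosRadoLT c y x) : y < x := by
  rw [ErdosRadoLT] at h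
  exact h.1

theorem color_eq {z y x : X} (h : ErdosRadoLT c y x) (hz : ErdosRadoLT c z y) :
    c z y = c z x := by
  rw [ErdosRadoLT] at h
  exact h.2 z hz.lt hz

theorem of_color_eq {y x : X} (h : y < x) (hz : ∀ z, ErdosRadoLT c z y → c z y = c z x) :
    ErdosRadoLT c y x := by
  rw [ErdosRadoLT]
  exact ⟨h, fun z _ => hz z⟩

theorem trans {y w x : X} (hy : ErdosRadoLT c y w) (hw : ErdosRadoLT c w x) :
    ErdosRadoLT c y x := by
  induction y using WellFoundedLT.induction generalizing w x with
  | ind y ih =>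
    refine of_color_eq (hy.lt.trans hw.lt) fun z hz => ?_
    rw [hy.color_eq hz, hw.color_eq (ih z hz.lt hz hy)]

/-- The predecessors of `x` form a chain: earlier predecessors see both `w` and `z` as they see `x`.
-/
theorem of_lt {w z x : X} (hw : ErdosRadoLT c w x) (hz : ErdosRadoLT c z x) (h : w < z) :
    ErdosRadoLT c w z := by
  induction w using WellFoundedLT.induction with
  | ind w ih =>
    refine of_color_eq h fun v hv => ?_
    have hvx := hv.trans hw
    rw [hw.color_eq hv, hz.color_eq (ih v hv.lt hvx (hv.lt.trans h))]

/-- Of two distinct points with the same coloured predecessors, the smaller would precede the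
larger, hence also itself. -/
theorem eq_of_forall {y y' : X} (h : ∀ z, ErdosRadoLT c z y ↔ ErdosRadoLT c z y')
    (hc : ∀ z, ErdosRadoLT c z y → c z y = c z y') : y = y' := by
  rcases lt_trichotomy y y' with hlt | heq | hgt
  · exact absurd ((h y).2 (of_color_eq hlt hc)).lt (lt_irrefl y)
  · exact heq
  · exact absurd ((h y').1 (of_color_eq hgt fun z hz => (hc z ((h z).2 hz)).symm)).lt
      (lt_irrefl y')

/-- The isomorphism type of the coloured chain of predecessors of `x`, read through `e`. -/
def code (c : X → X → C) (e : ∀ x, {y // ErdosRadoLT c y x} ↪ C) (x : X) : Set (C × C × C) :=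
  {t | ∃ y z : {y // ErdosRadoLT c y x}, y.1 ≤ z.1 ∧ t = (e x y, e x z, c y.1 x)}

/-- The member of the second chain that carries the name of `y` has, by induction, the same coloured
predecessors as `y`; `eq_of_forall` identifies the two. -/
theorem exists_of_code_eq {e : ∀ x, {y // ErdosRadoLT c y x} ↪ C} {x x' : X}
    (h : code c e x = code c e x') {y : X} (hy : ErdosRadoLT c y x) :
    ∃ hy' : ErdosRadoLT c y x', e x' ⟨y, hy'⟩ = e x ⟨y, hy⟩ ∧ c y x = c y x' := by
  induction y using WellFoundedLT.induction with
  | ind y ih =>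
    have hmem : (e x ⟨y, hy⟩, e x ⟨y, hy⟩, c y x) ∈ code c e x' := by
      rw [← h]
      exact ⟨⟨y, hy⟩, ⟨y, hy⟩, le_rfl, rfl⟩
    obtain ⟨⟨y', hy'⟩, w, -, h1⟩ := hmem
    simp only [Prod.mk.injEq] at h1
    obtain ⟨h1, -, h2⟩ := h1
    have below : ∀ z, ErdosRadoLT c z y → ErdosRadoLT c z y' := by
      intro z hz
      obtain ⟨hz', he, -⟩ := ih z hz.lt (hz.trans hy)
      have hmem : (e x ⟨z, hz.trans hy⟩, e x ⟨y, hy⟩, c z x) ∈ code c e x' := by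
        rw [← h]
        exact ⟨⟨z, hz.trans hy⟩, ⟨y, hy⟩, hz.lt.le, rfl⟩
      obtain ⟨a, b, hab, h3⟩ := hmem
      simp only [Prod.mk.injEq] at h3
      obtain ⟨h3, h4, -⟩ := h3
      rw [← he] at h3
      rw [h1] at h4
      have ha := (e x').injective h3
      have hb := (e x').injective h4
      subst ha hb
      refine hz'.of_lt hy' (lt_of_le_of_ne hab fun heq => ?_)
      change z = y' at heq
      subst heq
      rw [← h1] at he
      have := (e x).injective he
      simp only [Subtype.mk.injEq] at this
      exact hz.lt.ne this.symm
    have above : ∀ z, ErdosRadoLT c z y' → ErdosRadoLT c z y := by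
      intro z hz
      have hmem : (e x' ⟨z, hz.trans hy'⟩, e x' ⟨y', hy'⟩, c z x') ∈ code c e x := by
        rw [h]
        exact ⟨⟨z, hz.trans hy'⟩, ⟨y', hy'⟩, hz.lt.le, rfl⟩
      obtain ⟨⟨a, ha⟩, b, hab, h3⟩ := hmem
      simp only [Prod.mk.injEq] at h3
      obtain ⟨h3, h4, -⟩ := h3
      rw [← h1] at h4
      have hb := (e x).injective h4
      subst hb
      have hne : a ≠ y := by
        rintro rfl
        rw [h1] at h3
        have := (e x').injective h3
        simp only [Subtype.mk.injEq] at this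
        exact hz.lt.ne this
      have hlt : a < y := lt_of_le_of_ne hab hne
      obtain ⟨ha', he, -⟩ := ih a hlt ha
      rw [← he] at h3
      have := (e x').injective h3
      simp only [Subtype.mk.injEq] at this
      subst this
      exact ha.of_lt hy hlt
    have heq : y = y' := by
      refine eq_of_forall (c := c) (fun z => ⟨below z, above z⟩) fun z hz => ?_
      rw [hy.color_eq hz, hy'.color_eq (below z hz)]
      exact (ih z hz.lt (hz.trans hy)).2.2
    subst heq
    exact ⟨hy', h1.symm, h2⟩

theorem code_injective (e : ∀ x, {y // ErdosRadoLT c y x} ↪ C) :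
    Function.Injective (code c e) := by
  intro x x' h
  refine eq_of_forall (c := c) (fun z => ⟨fun hz => ?_, fun hz => ?_⟩) fun z hz => ?_
  · exact (exists_of_code_eq h hz).1
  · exact (exists_of_code_eq h.symm hz).1
  · exact (exists_of_code_eq h hz).2.2

end ErdosRadoLT

/-- A form of the Erdős–Rado theorem: a colouring with `#C` colours of the pairs from a
well-ordered set of more than `2 ^ #C` elements has an infinite homogeneous set. -/
theorem exists_infinite_homogeneous [Infinite C] (c : X → X → C) (hX : 2 ^ #C < #X) :
    ∃ (s : Set X) (d : C), s.Infinite ∧ ∀ y ∈ s, ∀ z ∈ s, y < z → c y z = d := by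
  -- Otherwise every chain can be named by elements of `C`, and the codes embed `X` into the power
  -- set of `C × C × C`.
  obtain ⟨x, hx⟩ : ∃ x, #C < #{y // ErdosRadoLT c y x} := by
    by_contra! hcon
    let e : ∀ x, {y // ErdosRadoLT c y x} ↪ C := fun x => ((Cardinal.le_def _ _).1 (hcon x)).some
    have := mk_le_of_injective (ErdosRadoLT.code_injective e)
    have hC : #(C × C × C) = #C := by
      simp [mul_eq_self (aleph0_le_mk C)]
    rw [mk_set, hC] at this
    exact this.not_gt hX
  -- Below `x` the colour of a pair depends only on its lower point, so a fibre of `c · x` is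
  -- homogeneous.
  obtain ⟨d, hd⟩ := exists_infinite_fiber' (fun y : {y // ErdosRadoLT c y x} => c y.1 x) hx
  refine ⟨Subtype.val '' ((fun y : {y // ErdosRadoLT c y x} => c y.1 x) ⁻¹' {d}), d,
    (Set.infinite_coe_iff.1 hd).image Subtype.val_injective.injOn, ?_⟩
  rintro _ ⟨⟨y, hy⟩, hyd, rfl⟩ _ ⟨⟨z, hz⟩, -, rfl⟩ hyz
  rw [hz.color_eq (hy.of_lt hz hyz)]
  exact hyd

end ErdosRado

/-! ### Completeness and pigeonhole for `atTop` on a regular cardinal. -/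

section FrequentlyAtTop

open Filter

/-- Fewer than `κ` thresholds are not cofinal, so some point exceeds them all. -/
theorem Cardinal.IsRegular.cardinalInterFilter_atTop {κ : Cardinal.{u}} (hκ : κ.IsRegular) :
    CardinalInterFilter (atTop : Filter κ.ord.ToType) κ where
  cardinal_sInter_mem S hS h := by
    have : Nonempty κ.ord.ToType := Ordinal.nonempty_toType_iff.2 hκ.ord_pos.ne'
    choose! a ha using fun s hs => mem_atTop_sets.1 (h s hs)
    have hcof : ¬ IsCofinal (a '' S) := fun hc => by
      have h1 := Order.cof_le hc
      rw [Ordinal.cof_toType, hκ.cof_ord] at h1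
      exact (h1.trans mk_image_le).not_gt hS
    simp only [IsCofinal, not_forall, not_exists, not_and, not_le] at hcof
    obtain ⟨b, hb⟩ := hcof
    refine mem_atTop_sets.2 ⟨b, fun x hx s hs => ha s hs x ?_⟩
    exact (hb _ ⟨s, hs, rfl⟩).le.trans hx

/-- Pigeonhole: if each `p · i` failed eventually, completeness would make all of them fail at once.
-/
theorem Filter.frequently_exists_of_mk_lt {α ι : Type u} {l : Filter α} {c : Cardinal.{u}}
    [CardinalInterFilter l c] (hc : #ι < c) {p : α → ι → Prop} (h : ∃ᶠ x in l, ∃ i, p x i) :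
    ∃ i, ∃ᶠ x in l, p x i := by
  by_contra! hcon
  refine h (((eventually_cardinal_forall hc).2 hcon).mono fun x hx => ?_)
  simpa using hx

theorem exists_strictMono_of_frequently_atTop {X : Type*} [LinearOrder X] [NoMaxOrder X]
    [Nonempty X] (b : X) {Q : ℕ → X → Prop} (h : ∀ n, ∃ᶠ x in atTop, Q n x) :
    ∃ β : ℕ → X, StrictMono β ∧ (∀ n, b < β n) ∧ ∀ n, Q n (β n) := by
  choose g hg hQ using fun n => frequently_atTop'.1 (h n)
  let β : ℕ → X := fun n => Nat.rec (g 0 b) (fun n x => g (n + 1) x) n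
  have hβ : StrictMono β := strictMono_nat_of_lt_succ fun n => hg (n + 1) (β n)
  refine ⟨β, hβ, fun n => (hg 0 b).trans_le (hβ.monotone (Nat.zero_le n)), fun n => ?_⟩
  cases n with
  | zero => exact hQ 0 b
  | succ n => exact hQ (n + 1) (β n)

theorem le_mk_of_frequently_atTop {κ : Cardinal.{u}} (hκ : κ.IsRegular) {A : Set κ.ord.ToType}
    (hA : ∃ᶠ x in atTop, x ∈ A) : κ ≤ #A := by
  have : Nonempty κ.ord.ToType := Ordinal.nonempty_toType_iff.2 hκ.ord_pos.ne'
  have hcof : IsCofinal A := fun x => by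
    obtain ⟨y, hxy, hy⟩ := frequently_atTop.1 hA x
    exact ⟨y, hy, hxy⟩
  have := Order.cof_le hcof
  rwa [Ordinal.cof_toType, hκ.cof_ord] at this

end FrequentlyAtTop

/-! ### The positive relation at μ⁺. -/

namespace TwoCardinal

open Filter

theorem exists_frequently_homogeneous {μ θ : Cardinal.{u}} (hμ : μ.IsStrongLimit)
    (hθ : IsCompactCardinal θ) (hcof : μ.ord.cof < θ) (hθμ : θ < μ)
    (f : (Order.succ μ).ord.ToType → (Order.succ μ).ord.ToType → μ.ord.ToType) (k : ℕ) :
    ∃ (a : Fin k → (Order.succ μ).ord.ToType) (c₁ c₂ : μ.ord.ToType), StrictMono a ∧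
      ∀ i j, i < j → ∃ᶠ γ in atTop, f (a i) γ = c₁ ∧ f (a j) γ = c₂ := by
  have hreg : (Order.succ μ).IsRegular := isRegular_succ hμ.aleph0_le
  have hinter := hreg.cardinalInterFilter_atTop
  have : Nonempty (Order.succ μ).ord.ToType := Ordinal.nonempty_toType_iff.2 hreg.ord_pos.ne'
  have : NoMaxOrder μ.ord.ToType := noMaxOrder hμ.aleph0_le
  obtain ⟨U, hU, hUθ⟩ := hθ.2.2 _ (atTop : Filter (Order.succ μ).ord.ToType) inferInstance
    (.of_cardinalInterFilter_of_lt _ (hθμ.trans (Order.lt_succ μ)))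
  obtain ⟨S, hS, hScard⟩ := Order.exists_cof_eq μ.ord.ToType
  rw [Ordinal.cof_toType] at hScard
  have hlt : #S < θ := hScard ▸ hcof
  have bounded : ∀ α, ∃ s : S, ∀ᶠ γ in (U : Filter _), f α γ < s := by
    intro α
    obtain ⟨s, hs⟩ := frequently_exists_of_mk_lt (l := (U : Filter _)) (p := fun γ s => f α γ < s)
      hlt (Frequently.of_forall fun γ => by
        obtain ⟨x, hx⟩ := exists_gt (f α γ)
        obtain ⟨s, hs, hxs⟩ := hS x
        exact ⟨⟨s, hs⟩, hx.trans_le hxs⟩)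
    exact ⟨s, Ultrafilter.frequently_iff_eventually.1 hs⟩
  obtain ⟨⟨s, _⟩, hA⟩ := frequently_exists_of_mk_lt (l := (U : Filter _))
    (p := fun α s => ∀ᶠ γ in (U : Filter _), f α γ < s) hlt (Frequently.of_forall bounded)
  set A : Set (Order.succ μ).ord.ToType := {α | ∀ᶠ γ in (U : Filter _), f α γ < s}
  have hAcard : Order.succ μ ≤ #A := le_mk_of_frequently_atTop hreg (hA.filter_mono hU)
  have hs : #(Set.Iio s) < μ := by
    simpa using mk_Iio_lt s (by simp)
  have hs2 : #(Set.Iio s × Set.Iio s) < μ := by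
    rw [mk_prod, lift_id]
    exact mul_lt_of_lt hμ.aleph0_le hs hs
  have pair : ∀ α β : A, ∃ p : Set.Iio s × Set.Iio s,
      ∃ᶠ γ in atTop, f α γ = p.1 ∧ f β γ = p.2 := by
    rintro ⟨α, hα⟩ ⟨β, hβ⟩
    -- The ultrafilter is only known to be θ-complete and there may be θ or more values below `s`,
    -- so the pigeonhole is applied to `atTop`.
    refine frequently_exists_of_mk_lt (hs2.trans (Order.lt_succ μ)) (Frequently.filter_mono ?_ hU)
    exact (hα.and hβ).frequently.mono fun γ h => ⟨(⟨_, h.1⟩, ⟨_, h.2⟩), rfl, rfl⟩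
  choose g hg using pair
  obtain ⟨α₀, hα₀⟩ := hA.exists
  obtain ⟨γ₀, hγ₀⟩ := hα₀.exists
  have : Nonempty (Set.Iio s) := ⟨⟨_, hγ₀⟩⟩
  -- The factor `ℕ` only makes the set of colours infinite, as `exists_infinite_homogeneous`
  -- requires.
  have hC : 2 ^ #(ULift.{u} ℕ × (Set.Iio s × Set.Iio s)) < #A := by
    refine (hμ.isStrongPrelimit ?_).trans_le ((Order.le_succ μ).trans hAcard)
    rw [mk_prod, lift_id, lift_id]
    exact mul_lt_of_lt hμ.aleph0_le (by simpa using hθ.1.trans hθμ) hs2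
  obtain ⟨H, ⟨n, d⟩, hH, hd⟩ := exists_infinite_homogeneous
    (fun α β : A => ((ULift.up 0 : ULift.{u} ℕ), g α β)) hC
  obtain ⟨t, htH, ht⟩ := hH.exists_subset_card_eq k
  refine ⟨fun i => (t.orderEmbOfFin ht i : A), d.1, d.2, fun i j hij => ?_, fun i j hij => ?_⟩
  · exact (t.orderEmbOfFin ht).strictMono hij
  · have h1 := hd _ (htH (t.orderEmbOfFin_mem ht i)) _ (htH (t.orderEmbOfFin_mem ht j))
      ((t.orderEmbOfFin ht).strictMono hij)
    rw [← (Prod.mk.inj h1).2]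
    exact hg _ _

theorem choose_two_add_lt {l₀ l₁ k : ℕ} (h : l₀ < l₁) (hk : l₁ < k) :
    l₁.choose 2 + l₀ < k.choose 2 := by
  have h1 : (l₁ + 1).choose 2 = l₁ + l₁.choose 2 := by simp [Nat.choose_succ_succ]
  have h2 := Nat.choose_le_choose 2 (Nat.succ_le_of_lt hk)
  rw [Nat.succ_eq_add_one] at h2
  omega

theorem mem_lowClass_iff {k : ℕ} {b : Finset (Fin (k + k.choose 2))} :
    b ∈ lowClass k ↔ ∃ (l₀ l₁ : Fin k) (j : Fin (k.choose 2)), l₀ < l₁ ∧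
      (j : ℕ) = (l₁ : ℕ).choose 2 + l₀ ∧ b = {Fin.castAdd _ l₀, Fin.natAdd k j} := by
  constructor
  · rintro ⟨l₀, l₁, h, hk, hb⟩
    refine ⟨⟨l₀, h.trans hk⟩, ⟨l₁, hk⟩, ⟨_, choose_two_add_lt h hk⟩, h, rfl, ?_⟩
    apply Finset.map_injective Fin.valEmbedding
    simp [hb, add_assoc]
  · rintro ⟨l₀, l₁, j, h, hj, rfl⟩
    exact ⟨l₀, l₁, h, l₁.2, by simp [hj, add_assoc]⟩

theorem mem_highClass_iff {k : ℕ} {b : Finset (Fin (k + k.choose 2))} :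
    b ∈ highClass k ↔ ∃ (l₀ l₁ : Fin k) (j : Fin (k.choose 2)), l₀ < l₁ ∧
      (j : ℕ) = (l₁ : ℕ).choose 2 + l₀ ∧ b = {Fin.castAdd _ l₁, Fin.natAdd k j} := by
  constructor
  · rintro ⟨l₀, l₁, h, hk, hb⟩
    refine ⟨⟨l₀, h.trans hk⟩, ⟨l₁, hk⟩, ⟨_, choose_two_add_lt h hk⟩, h, rfl, ?_⟩
    apply Finset.map_injective Fin.valEmbedding
    simp [hb, add_assoc]
  · rintro ⟨l₀, l₁, j, h, hj, rfl⟩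
    exact ⟨l₀, l₁, h, l₁.2, by simp [hj, add_assoc]⟩

theorem sId_mem_OID₂ {μ θ : Cardinal.{u}} (hμ : μ.IsStrongLimit) (hθ : IsCompactCardinal θ)
    (hcof : μ.ord.cof < θ) (hθμ : θ < μ) (k : ℕ) : sId k ∈ OID₂ (Order.succ μ) μ := by
  intro f
  have hreg : (Order.succ μ).IsRegular := isRegular_succ hμ.aleph0_le
  have : Nonempty (Order.succ μ).ord.ToType := Ordinal.nonempty_toType_iff.2 hreg.ord_pos.ne'
  have : NoMaxOrder (Order.succ μ).ord.ToType := noMaxOrder hreg.aleph0_le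
  obtain ⟨a, c₁, c₂, ha, hfreq⟩ := exists_frequently_homogeneous hμ hθ hcof hθμ
    (fun α γ => f {α, γ}) k
  obtain ⟨b, hb⟩ := Finite.exists_le a
  -- The index C(l₁, 2) + l₀ determines the pair l₀ < l₁; an index that codes no pair carries a
  -- vacuous requirement.
  obtain ⟨β, hβ, hbβ, hQ⟩ := exists_strictMono_of_frequently_atTop b
    (Q := fun n γ => ∀ l₀ l₁ : Fin k, l₀ < l₁ → n = (l₁ : ℕ).choose 2 + l₀ →
      f {a l₀, γ} = c₁ ∧ f {a l₁, γ} = c₂) (fun n => by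
    by_cases h : ∃ l₀ l₁ : Fin k, l₀ < l₁ ∧ n = (l₁ : ℕ).choose 2 + l₀
    · obtain ⟨l₀, l₁, hl, rfl⟩ := h
      refine (hfreq l₀ l₁ hl).mono fun γ hγ m₀ m₁ hm heq => ?_
      have h1 := choose_two_add_inj hl hm heq
      obtain rfl : l₁ = m₁ := Fin.ext h1
      obtain rfl : l₀ = m₀ := Fin.ext (by omega)
      exact hγ
    · exact Frequently.of_forall fun γ l₀ l₁ hl heq => (h ⟨l₀, l₁, hl, heq⟩).elim)
  have hmono : StrictMono (Fin.append a fun j : Fin (k.choose 2) => β j) := by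
    intro x y
    induction x using Fin.addCases <;> induction y using Fin.addCases
    · intro h
      simpa using ha h
    · simpa using fun _ => (hb _).trans_lt (hbβ _)
    · rename_i i j
      intro h
      have : k + (i : ℕ) < (j : ℕ) := h
      omega
    · intro h
      simpa using hβ ((Fin.natAdd_lt_natAdd_iff k).1 h)
  let h : Fin (k + k.choose 2) ↪o (Order.succ μ).ord.ToType := OrderEmbedding.ofStrictMono _ hmono
  have low : ∀ b ∈ lowClass k, f (b.map h.toEmbedding) = c₁ := by
    intro b hb
    obtain ⟨l₀, l₁, j, hl, hj, rfl⟩ := mem_lowClass_iff.1 hb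
    simpa [h] using (hQ j l₀ l₁ hl hj).1
  have high : ∀ b ∈ highClass k, f (b.map h.toEmbedding) = c₂ := by
    intro b hb
    obtain ⟨l₀, l₁, j, hl, hj, rfl⟩ := mem_highClass_iff.1 hb
    simpa [h] using (hQ j l₀ l₁ hl hj).2
  refine ⟨h, ?_⟩
  rintro b c (⟨hb, hc, heq | ⟨h1, h2⟩ | ⟨h1, h2⟩⟩ | rfl)
  · rw [(Subtype.mk.inj heq : b = c)]
  · exact (low _ h1).trans (low _ h2).symm
  · exact (high _ h1).trans (high _ h2).symm
  · rfl

theorem OID₂_subset_ID₂ (κ μ : Cardinal.{u}) : OID₂ κ μ ⊆ ID₂ κ μ := fun _ hs f =>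
  let ⟨h, hh⟩ := hs f
  ⟨h.toEmbedding, hh⟩

end TwoCardinal

/-! ### Separating levels and the combinatorics of level types. -/

section Separation

variable {X R : Type*} [LinearOrder X]

/-- If the sequence of invariants `r` becomes finer and finer and separates points, and if proper
initial segments of `X` are countable, then each pair `α < β` has a level `M α β` at which `α` and
`β` are separated from each other, and from each `α' < β` with `M α' β ≤ M α β`. -/
theorem exists_separating_level (hX : ∀ β : X, (Set.Iio β).Countable) (r : ℕ → X → R)
    (hmono : ∀ m m' x y, m ≤ m' → r m' x = r m' y → r m x = r m y)
    (hsep : ∀ x y, (∀ m, r m x = r m y) → x = y) :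
    ∃ M : X → X → ℕ, (∀ α β, α < β → r (M α β) α ≠ r (M α β) β) ∧
      ∀ α α' β, α < β → α' < β → M α' β ≤ M α β → r (M α β) α = r (M α β) α' → α = α' := by
  choose e he using fun β => Set.countable_iff_exists_injOn.1 (hX β)
  have fin : ∀ β n, (insert β {γ | γ < β ∧ e β γ ≤ n}).Finite := fun β n =>
    (Set.Finite.of_finite_image (f := e β)
      ((Set.finite_Iic n).subset (by rintro _ ⟨γ, h, rfl⟩; exact h.2))
      ((he β).mono fun γ h => h.1)).insert β
  have sep : ∀ β n, ∃ m, ∀ x ∈ insert β {γ | γ < β ∧ e β γ ≤ n},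
      ∀ y ∈ insert β {γ | γ < β ∧ e β γ ≤ n}, r m x = r m y → x = y := fun β n => by
    refine Filter.Eventually.exists (f := Filter.atTop) ?_
    refine (Filter.eventually_all_finite (fin β n)).2 fun x _ =>
      (Filter.eventually_all_finite (fin β n)).2 fun y _ => ?_
    by_cases hxy : x = y
    · exact Filter.Eventually.of_forall fun _ _ => hxy
    · obtain ⟨m, hm⟩ := not_forall.1 fun h => hxy (hsep x y h)
      filter_upwards [Filter.eventually_ge_atTop m] with m' hm' h
      exact (hm (hmono m m' x y hm' h)).elim
  choose D hD using sep
  -- The sum dominates `D β n`, so it still separates; the `+ 1` makes `N β` strictly increasing, so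
  -- comparing levels over `β` compares the indices `e β`.
  let N : X → ℕ → ℕ := fun β n => ∑ i ∈ Finset.range (n + 1), (D β i + 1)
  have hN : ∀ β, StrictMono (N β) := fun β => strictMono_nat_of_lt_succ fun n => by
    simp only [N, Finset.sum_range_succ _ (n + 1)]
    omega
  have hDN : ∀ β n, D β n ≤ N β n := fun β n => by
    simp only [N, Finset.sum_range_succ _ n]
    omega
  refine ⟨fun α β => N β (e β α), fun α β h heq => h.ne ?_, fun α α' β h h' hle heq => ?_⟩
  · exact hD β (e β α) α (Or.inr ⟨h, le_rfl⟩) β (Or.inl rfl) (hmono _ _ _ _ (hDN _ _) heq)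
  · exact hD β (e β α) α (Or.inr ⟨h, le_rfl⟩) α' (Or.inr ⟨h', (hN β).le_iff_le.1 hle⟩)
      (hmono _ _ _ _ (hDN _ _) heq)

/-- The pair `x < y` has level `m`, and its lower and upper points have the invariants `s`, `t` at
that level. -/
structure HasLevelType (r : ℕ → X → R) (M : X → X → ℕ) (m : ℕ) (s t : R) (x y : X) : Prop where
  lt : x < y
  level : M x y = m
  lower : r m x = s
  upper : r m y = t

namespace HasLevelType

variable {r : ℕ → X → R} {M : X → X → ℕ} {m m' : ℕ} {s t s' t' : R}

theorem ne (hM : ∀ α β, α < β → r (M α β) α ≠ r (M α β) β) {x y : X}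
    (h : HasLevelType r M m s t x y) : s ≠ t := by
  have := hM x y h.lt
  rwa [h.level, h.lower, h.upper] at this

/-- The common point is not lower in one pair and upper in the other, as `s ≠ t`; if it were upper
in both, `hM'` would identify the lower points. -/
theorem of_common (hM : ∀ α β, α < β → r (M α β) α ≠ r (M α β) β)
    (hM' : ∀ α α' β, α < β → α' < β → M α' β ≤ M α β → r (M α β) α = r (M α β) α' → α = α')
    {x y z : X} (hyz : y ≠ z)
    (hy : HasLevelType r M m s t x y ∨ HasLevelType r M m s t y x)
    (hz : HasLevelType r M m s t x z ∨ HasLevelType r M m s t z x) :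
    HasLevelType r M m s t x y ∧ HasLevelType r M m s t x z := by
  rcases hy with hy | hy <;> rcases hz with hz | hz
  · exact ⟨hy, hz⟩
  · exact (hy.ne hM (hy.lower.symm.trans hz.upper)).elim
  · exact (hy.ne hM (hz.lower.symm.trans hy.upper)).elim
  · refine (hyz (hM' y z x hy.lt hz.lt (hz.level.trans hy.level.symm).le ?_)).elim
    rw [hy.level, hy.lower, hz.lower]

/-- At the coarser level `m'` the points `u` and `v` agree, so `u` is upper in its pair with `y`.
Likewise `y` cannot be upper in its pair with `w`, where it would agree with `v`. Hence `x` and `y`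
both lie below `u` with invariant `s` at level `m`, and `hM'` applies. -/
theorem eq_of_le (hM : ∀ α β, α < β → r (M α β) α ≠ r (M α β) β)
    (hM' : ∀ α α' β, α < β → α' < β → M α' β ≤ M α β → r (M α β) α = r (M α β) α' → α = α')
    (hmono : ∀ m m' x y, m ≤ m' → r m' x = r m' y → r m x = r m y)
    {x y z u v w : X} (hxu : HasLevelType r M m s t x u)
    (hxv : HasLevelType r M m s t x v)
    (hyw : HasLevelType r M m s t y w ∨ HasLevelType r M m s t w y)
    (hzv : HasLevelType r M m' s' t' z v)
    (hyu : HasLevelType r M m' s' t' y u ∨ HasLevelType r M m' s' t' u y) (hle : m' ≤ m) :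
    x = y := by
  have hu : r m' u = t' := by
    rw [← hzv.upper]
    exact hmono _ _ _ _ hle (hxu.upper.trans hxv.upper.symm)
  have hyu : HasLevelType r M m' s' t' y u :=
    hyu.resolve_right fun h => hzv.ne hM (h.lower.symm.trans hu)
  have hyw : HasLevelType r M m s t y w := hyw.resolve_right fun h =>
    hzv.ne hM (hyu.lower.symm.trans ((hmono _ _ _ _ hle
      (h.upper.trans hxv.upper.symm)).trans hzv.upper))
  refine hM' x y u hxu.lt hyu.lt (by rw [hxu.level, hyu.level]; exact hle) ?_
  rw [hxu.level, hxu.lower, hyw.lower]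

end HasLevelType

end Separation

/-! ### The negative relation at ℵ₁. -/

namespace TwoCardinal

theorem exists_fine_invariants : ∃ r : ℕ → (ℵ_ 1 : Cardinal.{u}).ord.ToType → Finset ℕ,
    (∀ m m' x y, m ≤ m' → r m' x = r m' y → r m x = r m y) ∧
      ∀ x y, (∀ m, r m x = r m y) → x = y := by
  classical
  obtain ⟨ρ⟩ : Nonempty ((ℵ_ 1 : Cardinal.{u}).ord.ToType ↪ Set ℕ) := by
    rw [← lift_mk_le']
    simpa using aleph_one_le_continuum
  refine ⟨fun m x => {i ∈ Finset.range m | i ∈ ρ x}, fun m m' x y hle h => ?_, fun x y h => ?_⟩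
  · ext i
    have := congrArg (i ∈ ·) h
    simp only [Finset.mem_filter, Finset.mem_range, eq_iff_iff] at this ⊢
    constructor
    · exact fun hi => ⟨hi.1, (this.1 ⟨hi.1.trans_le hle, hi.2⟩).2⟩
    · exact fun hi => ⟨hi.1, (this.2 ⟨hi.1.trans_le hle, hi.2⟩).2⟩
  · refine ρ.injective (Set.ext fun i => ?_)
    have := congrArg (i ∈ ·) (h (i + 1))
    simpa using this

theorem exists_forall_pair_eq_imp {X R : Type*} [LinearOrder X] [Countable R] (r : ℕ → X → R)
    (M : X → X → ℕ) : ∃ f : Finset X → (ℵ₀ : Cardinal.{u}).ord.ToType,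
      ∀ x y, ∃ m s t, ∀ x' y', x' ≠ y' → f {x', y'} = f {x, y} →
        HasLevelType r M m s t x' y' ∨ HasLevelType r M m s t y' x' := by
  classical
  obtain ⟨g⟩ : Nonempty (Option (ℕ × R × R) ↪ (ℵ₀ : Cardinal.{u}).ord.ToType) := by
    rw [← lift_mk_le', mk_ord_toType, lift_aleph0]
    exact lift_le_aleph0.2 mk_le_aleph0
  let code : X → X → Option (ℕ × R × R) := fun x y => some (M x y, r (M x y) x, r (M x y) y)
  let f : Finset X → (ℵ₀ : Cardinal.{u}).ord.ToType := fun b =>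
    -- Only pairs matter; other finite sets get arbitrary colours.
    g (if h : b.Nonempty then code (b.min' h) (b.max' h) else none)
  have hf : ∀ x y, f {x, y} = g (code (min x y) (max x y)) := fun x y => by simp [f]
  have key : ∀ x y x' y', x' < y' → f {x', y'} = g (code x y) →
      HasLevelType r M (M x y) (r (M x y) x) (r (M x y) y) x' y' := by
    intro x y x' y' hlt heq
    rw [hf, min_eq_left hlt.le, max_eq_right hlt.le] at heq
    have := g.injective heq
    simp only [code, Option.some.injEq, Prod.mk.injEq] at this
    obtain ⟨h1, h2, h3⟩ := this
    rw [h1] at h2 h3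
    exact ⟨hlt, h1, h2, h3⟩
  refine ⟨f, fun x y => ⟨M (min x y) (max x y), r (M (min x y) (max x y)) (min x y),
    r (M (min x y) (max x y)) (max x y), fun x' y' hne heq => ?_⟩⟩
  rw [hf x y] at heq
  rcases hne.lt_or_gt with h | h
  · exact Or.inl (key _ _ _ _ h heq)
  · rw [Finset.pair_comm] at heq
    exact Or.inr (key _ _ _ _ h heq)

theorem sId_notMem_ID₂ {k : ℕ} (hk : 3 ≤ k) : sId k ∉ ID₂ (ℵ_ 1 : Cardinal.{u}) ℵ₀ := by
  intro hmem
  obtain ⟨r, hmono, hsep⟩ := exists_fine_invariants.{u}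
  obtain ⟨M, hM, hM'⟩ := exists_separating_level (fun β => by
    have h : #(Set.Iio β) < ℵ_ 1 := by
      simpa using mk_Iio_lt β (by simp)
    rw [← le_aleph0_iff_set_countable, ← Order.lt_succ_iff]
    simpa using h) r hmono hsep
  obtain ⟨f, hf⟩ := exists_forall_pair_eq_imp.{u} r M
  obtain ⟨h, hh⟩ : ∃ h : Fin (k + k.choose 2) ↪ (ℵ_ 1 : Cardinal.{u}).ord.ToType,
      ∀ b c, (sRel k).plus.rel b c → f (b.map h) = f (c.map h) := hmem f
  have card : ∀ (l : Fin k) (j : Fin (k.choose 2)),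
      ({Fin.castAdd _ l, Fin.natAdd k j} : Finset (Fin (k + k.choose 2))).card = 2 :=
    fun l j => Finset.card_pair fun heq => by
      have := congrArg Fin.val heq
      simp only [Fin.val_castAdd, Fin.val_natAdd] at this
      omega
  let α : Fin k → (ℵ_ 1 : Cardinal.{u}).ord.ToType := fun l => h (Fin.castAdd _ l)
  let β : Fin (k.choose 2) → (ℵ_ 1 : Cardinal.{u}).ord.ToType := fun j => h (Fin.natAdd k j)
  have hα : Function.Injective α := h.injective.comp (Fin.castAdd_injective _ _)
  have hβ : Function.Injective β := h.injective.comp (Fin.natAdd_injective _ _)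
  have hαβ : ∀ l j, α l ≠ β j := fun l j heq => by
    have := congrArg Fin.val (h.injective heq)
    simp only [Fin.val_castAdd, Fin.val_natAdd] at this
    omega
  have map_pair : ∀ (l : Fin k) (j : Fin (k.choose 2)),
      ({Fin.castAdd _ l, Fin.natAdd k j} : Finset (Fin (k + k.choose 2))).map h = {α l, β j} :=
    fun l j => by simp [α, β]
  have low : ∀ (l₀ l₁ l₀' l₁' : Fin k) (j j' : Fin (k.choose 2)), l₀ < l₁ → l₀' < l₁' →
      (j : ℕ) = (l₁ : ℕ).choose 2 + l₀ → (j' : ℕ) = (l₁' : ℕ).choose 2 + l₀' →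
      f {α l₀, β j} = f {α l₀', β j'} := fun l₀ l₁ l₀' l₁' j j' hl hl' hj hj' => by
    have := hh _ _ (Or.inl ⟨card l₀ j, card l₀' j', Or.inr (Or.inl
      ⟨mem_lowClass_iff.2 ⟨l₀, l₁, j, hl, hj, rfl⟩,
        mem_lowClass_iff.2 ⟨l₀', l₁', j', hl', hj', rfl⟩⟩)⟩)
    rwa [map_pair, map_pair] at this
  have high : ∀ (l₀ l₁ l₀' l₁' : Fin k) (j j' : Fin (k.choose 2)), l₀ < l₁ → l₀' < l₁' →
      (j : ℕ) = (l₁ : ℕ).choose 2 + l₀ → (j' : ℕ) = (l₁' : ℕ).choose 2 + l₀' →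
      f {α l₁, β j} = f {α l₁', β j'} := fun l₀ l₁ l₀' l₁' j j' hl hl' hj hj' => by
    have := hh _ _ (Or.inl ⟨card l₁ j, card l₁' j', Or.inr (Or.inr
      ⟨mem_highClass_iff.2 ⟨l₀, l₁, j, hl, hj, rfl⟩,
        mem_highClass_iff.2 ⟨l₀', l₁', j', hl', hj', rfl⟩⟩)⟩)
    rwa [map_pair, map_pair] at this
  have h3 : 3 ≤ k.choose 2 := Nat.choose_le_choose 2 hk
  let i₀ : Fin k := ⟨0, by omega⟩
  let i₁ : Fin k := ⟨1, by omega⟩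
  let i₂ : Fin k := ⟨2, by omega⟩
  have h01 : i₀ < i₁ := by simp [i₀, i₁]
  have h02 : i₀ < i₂ := by simp [i₀, i₂]
  have h12 : i₁ < i₂ := by simp [i₁, i₂]
  let j₀ : Fin (k.choose 2) := ⟨0, by omega⟩
  let j₁ : Fin (k.choose 2) := ⟨1, by omega⟩
  let j₂ : Fin (k.choose 2) := ⟨2, by omega⟩
  have e01 : (j₀ : ℕ) = (i₁ : ℕ).choose 2 + i₀ := by simp [j₀, i₁, i₀]
  have e02 : (j₁ : ℕ) = (i₂ : ℕ).choose 2 + i₀ := by simp [j₁, i₂, i₀]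
  have e12 : (j₂ : ℕ) = (i₂ : ℕ).choose 2 + i₁ := by simp [j₂, i₂, i₁]
  have d01 : β j₀ ≠ β j₁ := hβ.ne (by simp [j₀, j₁])
  have d12 : β j₁ ≠ β j₂ := hβ.ne (by simp [j₁, j₂])
  obtain ⟨m, s, t, ha⟩ := hf (α i₀) (β j₀)
  obtain ⟨m', s', t', hb⟩ := hf (α i₁) (β j₀)
  obtain ⟨ha0, ha1⟩ := HasLevelType.of_common hM hM' d01 (ha _ _ (hαβ _ _) rfl)
    (ha _ _ (hαβ _ _) (low _ _ _ _ _ _ h02 h01 e02 e01))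
  obtain ⟨hb1, hb2⟩ := HasLevelType.of_common hM hM' d12
    (hb _ _ (hαβ _ _) (high _ _ _ _ _ _ h02 h01 e02 e01))
    (hb _ _ (hαβ _ _) (high _ _ _ _ _ _ h12 h01 e12 e01))
  have ha2 := ha _ _ (hαβ _ _) (low _ _ _ _ _ _ h12 h01 e12 e01)
  have hb0 := hb _ _ (hαβ _ _) rfl
  -- The second case is the mirror image of the first: the two classes trade places, as do `i₀` with
  -- `i₂` and `j₀` with `j₂`.
  rcases le_total m' m with hle | hle
  · exact h01.ne (hα (ha0.eq_of_le hM hM' hmono ha1 ha2 hb1 hb0 hle))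
  · exact h12.ne' (hα (hb2.eq_of_le hM hM' hmono hb1 hb0 ha1 ha2 hle))

end TwoCardinal

/-! ### The classes of s_3. -/

namespace TwoCardinal

theorem lowClass_three : lowClass 3 = {{0, 3}, {0, 4}, {1, 5}} := by
  ext b
  rw [mem_lowClass_iff]
  constructor
  · rintro ⟨l₀, l₁, j, hl, hj, rfl⟩
    revert l₀ l₁ j
    decide
  · rintro (rfl | rfl | rfl)
    · exact ⟨0, 1, ⟨0, by decide⟩, by decide⟩
    · exact ⟨0, 2, ⟨1, by decide⟩, by decide⟩
    · exact ⟨1, 2, ⟨2, by decide⟩, by decide⟩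

theorem highClass_three : highClass 3 = {{1, 3}, {2, 4}, {2, 5}} := by
  ext b
  rw [mem_highClass_iff]
  constructor
  · rintro ⟨l₀, l₁, j, hl, hj, rfl⟩
    revert l₀ l₁ j
    decide
  · rintro (rfl | rfl | rfl)
    · exact ⟨0, 1, ⟨0, by decide⟩, by decide⟩
    · exact ⟨0, 2, ⟨1, by decide⟩, by decide⟩
    · exact ⟨1, 2, ⟨2, by decide⟩, by decide⟩

theorem card_eq_two_of_mem_lowClass {k : ℕ} {b : Finset (Fin (k + k.choose 2))}
    (hb : b ∈ lowClass k) : b.card = 2 := by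
  obtain ⟨l₀, l₁, h, hk, hb⟩ := hb
  rw [← Finset.card_map Fin.valEmbedding, hb, Finset.card_pair (by omega)]

theorem card_eq_two_of_mem_highClass {k : ℕ} {b : Finset (Fin (k + k.choose 2))}
    (hb : b ∈ highClass k) : b.card = 2 := by
  obtain ⟨l₀, l₁, h, hk, hb⟩ := hb
  rw [← Finset.card_map Fin.valEmbedding, hb, Finset.card_pair (by omega)]

/-- Nontriviality is a genuine condition: for `k ≤ 2` each of the two sets has at most one element.
-/
theorem nonsingletonClasses_sRel {k : ℕ} (hlow : (lowClass k).Nontrivial)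
    (hhigh : (highClass k).Nontrivial) :
    TwoIdentity.nonsingletonClasses (sRel k) = {lowClass k, highClass k} := by
  have of_low : ∀ b : {b : Finset (Fin (k + k.choose 2)) // b.card = 2}, b.1 ∈ lowClass k →
      Subtype.val '' {c | (sRel k).r c b} = lowClass k := fun b hb => by
    ext c
    constructor
    · rintro ⟨c, rfl | ⟨hc, -⟩ | ⟨-, hc⟩, rfl⟩
      · exact hb
      · exact hc
      · exact (not_mem_highClass_of_mem_lowClass hb hc).elim
    · exact fun hc => ⟨⟨c, card_eq_two_of_mem_lowClass hc⟩, Or.inr (Or.inl ⟨hc, hb⟩), rfl⟩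
  have of_high : ∀ b : {b : Finset (Fin (k + k.choose 2)) // b.card = 2}, b.1 ∈ highClass k →
      Subtype.val '' {c | (sRel k).r c b} = highClass k := fun b hb => by
    ext c
    constructor
    · rintro ⟨c, rfl | ⟨-, hc⟩ | ⟨hc, -⟩, rfl⟩
      · exact hb
      · exact (not_mem_highClass_of_mem_lowClass hc hb).elim
      · exact hc
    · exact fun hc => ⟨⟨c, card_eq_two_of_mem_highClass hc⟩, Or.inr (Or.inr ⟨hc, hb⟩), rfl⟩
  ext C
  constructor
  · rintro ⟨_, ⟨b, rfl⟩, ⟨c, hc, d, hd, hcd⟩, rfl⟩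
    have : b.1 ∈ lowClass k ∨ b.1 ∈ highClass k := by
      rcases hc with rfl | ⟨-, h⟩ | ⟨-, h⟩
      · rcases hd with rfl | ⟨-, h⟩ | ⟨-, h⟩
        · exact (hcd rfl).elim
        · exact Or.inl h
        · exact Or.inr h
      · exact Or.inl h
      · exact Or.inr h
    exact this.imp (of_low b) (of_high b)
  · rintro (rfl | rfl)
    · obtain ⟨b, hb⟩ := hlow.nonempty
      have heq := of_low ⟨b, card_eq_two_of_mem_lowClass hb⟩ hb
      exact ⟨_, ⟨_, rfl⟩, Set.nontrivial_of_image _ _ (heq ▸ hlow), heq.symm⟩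
    · obtain ⟨b, hb⟩ := hhigh.nonempty
      have heq := of_high ⟨b, card_eq_two_of_mem_highClass hb⟩ hb
      exact ⟨_, ⟨_, rfl⟩, Set.nontrivial_of_image _ _ (heq ▸ hhigh), heq.symm⟩

/-- The image of a set of points of `s_3` under the transposition of `3` and `5`. -/
def swapImage (b : Finset (Fin (3 + Nat.choose 3 2))) : Finset ℕ :=
  b.image fun i : Fin (3 + Nat.choose 3 2) => Equiv.swap (3 : ℕ) 5 (i : ℕ)

theorem swapImage_lowClass : swapImage '' lowClass 3 = {{1, 3}, {0, 4}, {0, 5}} := by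
  have h1 : swapImage {0, 3} = {0, 5} := by decide
  have h2 : swapImage {0, 4} = {0, 4} := by decide
  have h3 : swapImage {1, 5} = {1, 3} := by decide
  rw [lowClass_three, Set.image_insert_eq, Set.image_pair, h1, h2, h3, Set.insert_comm,
    Set.pair_comm, Set.insert_comm, Set.insert_comm, Set.pair_comm, Set.insert_comm]

theorem swapImage_highClass : swapImage '' highClass 3 = {{1, 5}, {2, 3}, {2, 4}} := by
  have h1 : swapImage {1, 3} = {1, 5} := by decide
  have h2 : swapImage {2, 4} = {2, 4} := by decide
  have h3 : swapImage {2, 5} = {2, 3} := by decide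
  rw [highClass_three, Set.image_insert_eq, Set.image_pair, h1, h2, h3, Set.pair_comm {2, 4}]

theorem nonsingletonClasses_sId_three :
    {D | ∃ C ∈ TwoIdentity.nonsingletonClasses (sId 3).2, D = swapImage '' C} =
      {{{1, 3}, {0, 4}, {0, 5}}, {{1, 5}, {2, 3}, {2, 4}}} := by
  have hclasses : TwoIdentity.nonsingletonClasses (sId 3).2 = {lowClass 3, highClass 3} :=
    nonsingletonClasses_sRel
      (by rw [lowClass_three]; exact ⟨{0, 3}, by simp, {0, 4}, by simp, by decide⟩)
      (by rw [highClass_three]; exact ⟨{1, 3}, by simp, {2, 4}, by simp, by decide⟩)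
  rw [hclasses, ← swapImage_lowClass, ← swapImage_highClass]
  ext D
  constructor
  · rintro ⟨C, rfl | rfl, rfl⟩
    · exact Or.inl rfl
    · exact Or.inr rfl
  · rintro (rfl | rfl)
    · exact ⟨_, Or.inl rfl, rfl⟩
    · exact ⟨_, Or.inr rfl, rfl⟩

end TwoCardinal

theorem claim2p1 :
    (∀ μ θ : Cardinal.{u}, μ.IsStrongLimit → TwoCardinal.IsCompactCardinal θ →
      μ.ord.cof < θ → θ < μ →
        (∀ k : ℕ, TwoCardinal.sId k ∈ TwoCardinal.ID₂ (Order.succ μ) μ ∧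
          TwoCardinal.sId k ∈ TwoCardinal.OID₂ (Order.succ μ) μ) ∧
        (∀ k : ℕ, 3 ≤ k → TwoCardinal.sId k ∈
          TwoCardinal.ID₂ (Order.succ μ) μ \
            TwoCardinal.ID₂ (Cardinal.aleph 1 : Cardinal.{u}) Cardinal.aleph0)) ∧
    (∀ k : ℕ, 3 ≤ k →
      TwoCardinal.sId k ∉ TwoCardinal.ID₂ (Cardinal.aleph 1 : Cardinal.{u}) Cardinal.aleph0) ∧
    ((TwoCardinal.sId 3).1 = 6 ∧
      {D : Set (Finset ℕ) | ∃ C ∈ TwoCardinal.TwoIdentity.nonsingletonClasses (TwoCardinal.sId 3).2,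
          D = (fun b : Finset (Fin (TwoCardinal.sId 3).1) =>
            b.image (fun i : Fin (TwoCardinal.sId 3).1 => Equiv.swap (3 : ℕ) 5 (i : ℕ))) '' C} =
        {{{1, 3}, {0, 4}, {0, 5}}, {{1, 5}, {2, 3}, {2, 4}}}) := by
 
  refine ⟨fun μ θ hμ hθ hcof hθμ => ?_, fun k hk => TwoCardinal.sId_notMem_ID₂ hk, rfl,
    TwoCardinal.nonsingletonClasses_sId_three⟩
  have hO := TwoCardinal.sId_mem_OID₂ hμ hθ hcof hθμ
  have hI := fun k => TwoCardinal.OID₂_subset_ID₂ _ _ (hO k)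
  exact ⟨fun k => ⟨hI k, hO k⟩, fun k hk => ⟨hI k, TwoCardinal.sId_notMem_ID₂ hk⟩⟩
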